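/- For graphs $F$ and $G$ let $\mathcal N(F,G)$ denote the number of (not necessarily induced) subgraphs of $G$ isomorphic to $F$. For natural numbers $n$ and $m$ and graphs $F$ and $H$, let $\mathrm{satex}(n,F:m,H)$ be the minimum of $\mathcal N(H,G)$ over all $n$-vertex graphs $G$ with $\mathcal N(F,G)\ge m$ (with value $+\infty$ if there is no such $G$). Let $P_{k+1}$ be the path on $k+1$ vertices and $C_{2k}$ the cycle on $2k$ vertices. **Theorem.** Let $k\ge 2$ be a fixed integer and let $m=m(n)$ be a sequence of natural numbers with $m\gg n^k$, that is, $m(n)/n^k\to\infty$ as $n\to\infty$. Then $$\mathrm{satex}(n,P_{k+1}:m,C_{2k})\ \ge\ \left(\frac1k-o(1)\right)\left(\frac mn\right)^2\qquad(n\to\infty).$$ That is, there is a sequence $\varepsilon(n)\to 0$ such that, for all sufficiently large $n$, every $n$-vertex graph with at least $m(n)$ copies of $P_{k+1}$ contains at least $\left(\frac1k-\varepsilon(n)\right)\left(\frac{m(n)}{n}\right)^2$ cycles $C_{2k}$. -/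

import Mathlib

open Filter Topology

/-- The number `𝒩(F, G)` of (not necessarily induced) subgraphs of `G` that are isomorphic to `F`
is `G.copyCount F`. The supersaturation-extremal function `satex(n, F : m, H)` is the least number
of copies of `H` in an `n`-vertex graph that has at least `m` copies of `F`; it is `⊤` when no
`n`-vertex graph has `m` copies of `F`. -/
noncomputable def satex {α β : Type*} (n : ℕ) (F : SimpleGraph α) (m : ℕ) (H : SimpleGraph β) :
    ℕ∞ :=
  ⨅ (G : SimpleGraph (Fin n)) (_ : m ≤ G.copyCount F), (G.copyCount H : ℕ∞)

/-!
# Many paths force many even cycles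

Let `A` be the adjacency matrix of a graph `G` on `n` vertices and let `H = tr A ^ (2 * k)` be the
number of closed walks of length `2 * k`. Every copy of the path with `k` edges gives two walks of
length `k`, and the squares of the entries of `A ^ k` sum to `H`; so the Cauchy–Schwarz inequality
(`Matrix.IsSymm.sum_sum_pow_sq_le`) turns `m` paths into `H ≥ 4 * (m / n) ^ 2`. On the other hand a
cycle of length `2 * k` has at most `4 * k` automorphisms, so it accounts for at most `4 * k` closed
walks. The factor `1 / k` is the quotient of the two constants, and what remains is to show that
almost all closed walks of length `2 * k` trace out cycles.

A closed walk that does not visits some vertex `x` at two distinct positions, and therefore splits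
into closed walks at `x` of lengths `l` and `2 * k - l`. For fixed `x` let `q s` be the diagonal
entry of `A ^ (2 * s)` at `x`. By the Cauchy–Schwarz inequality `q` is log-convex with `q 0 = 1`,
and hence the number of such pairs of walks is at most `q 1 * q (k - 1)`, whatever `l` is
(`Matrix.IsSymm.pow_apply_self_mul_le`). Log-convexity also yields, for every `η > 0`,
`q 1 * q (k - 1) ≤ η * q k + η ^ (1 - k) * q 1 ^ k` (`mul_le_add_pow_of_sq_le`). Here `q 1` is the
degree of `x`, and the sum of the `k`-th powers of the degrees is at most
`θ * H + n ^ (2 * k - 2) / θ` for `0 < θ ≤ 1` (`SimpleGraph.sum_degree_pow_le`). Altogether the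
degenerate closed walks number at most `δ * H + C * n ^ (2 * k - 2)` with `C` depending only on `δ`
and `k`, and the last term is negligible against `(m / n) ^ 2` exactly because `m / n ^ k` tends to
infinity.
-/

/-! ### Labelled and unlabelled copies -/

namespace SimpleGraph

open Finset

section Copies

variable {V W : Type*} [Fintype V] [Fintype W] {G : SimpleGraph V} {H : SimpleGraph W}

lemma labelledCopyCount_eq_natCard (G : SimpleGraph V) (H : SimpleGraph W) :
    G.labelledCopyCount H = Nat.card (Copy H G) := by
  classical
  rw [labelledCopyCount, Nat.card_eq_fintype_card]

/-- Two labelled copies of `H` with the same image differ by an injective endomorphism of `H`. -/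
lemma labelledCopyCount_le_mul_copyCount (G : SimpleGraph V) (H : SimpleGraph W) :
    G.labelledCopyCount H ≤ H.labelledCopyCount H * G.copyCount H := by
  classical
  rw [copyCount_eq_card_image_copyToSubgraph, labelledCopyCount, labelledCopyCount]
  rw [← card_univ (α := Copy H G)]
  refine card_le_mul_card_image _ _ fun S hS ↦ ?_
  obtain ⟨f₀, -, rfl⟩ := mem_image.1 hS
  have hlift (f : Copy H G) (hf : f.toSubgraph = f₀.toSubgraph) :
      ∃ σ : Copy H H, ∀ i, f₀ (σ i) = f i := by
    have hv (i : W) : ∃ j, f₀ j = f i := by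
      have : f i ∈ f.toSubgraph.verts := by simp [Copy.toSubgraph]
      rw [hf] at this
      simpa [Copy.toSubgraph] using this
    choose σ hσ using hv
    refine ⟨⟨⟨σ, fun {a b} hab ↦ ?_⟩, fun a b hab ↦ ?_⟩, hσ⟩
    · have h : f.toSubgraph.Adj (f a) (f b) := ⟨a, b, by simpa using hab, rfl, rfl⟩
      rw [hf] at h
      obtain ⟨a', b', h', ha, hb⟩ := h
      rw [← hσ] at ha hb
      rw [← f₀.injective ha, ← f₀.injective hb]
      simpa using h'
    · apply f.injective
      change f a = f b
      rw [← hσ, ← hσ]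
      exact congrArg f₀ hab
  have : Nonempty (Copy H H) := ⟨(hlift f₀ rfl).choose⟩
  choose! σ hσ using hlift
  rw [← card_univ]
  refine card_le_card_of_injOn σ (fun _ _ ↦ mem_coe.2 (mem_univ _)) fun f hf g hg hfg ↦ ?_
  simp only [coe_filter, mem_univ, true_and, Set.mem_ofPred_eq] at hf hg
  ext i
  rw [← hσ f hf, ← hσ g hg, hfg]

/-- Along the cycle an injective endomorphism `f` moves by constant steps `1` or `-1`, so it is
determined by `f 0` and `f 1`. -/
lemma labelledCopyCount_cycleGraph_self_le (n : ℕ) :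
    (cycleGraph (n + 3)).labelledCopyCount (cycleGraph (n + 3)) ≤ 2 * (n + 3) := by
  have hstep (f : Copy (cycleGraph (n + 3)) (cycleGraph (n + 3))) (i : Fin (n + 3)) :
      f (i + 1) - f i = 1 ∨ f (i + 1) - f i = -1 := by
    have h : (cycleGraph (n + 3)).Adj (f (i + 1)) (f i) :=
      f.toHom.map_adj (cycleGraph_adj.2 (Or.inl (by simp)))
    rcases cycleGraph_adj.1 h with h | h
    · exact Or.inl h
    · exact Or.inr ((neg_sub _ _).symm.trans (congrArg Neg.neg h))
  have hconst (f : Copy (cycleGraph (n + 3)) (cycleGraph (n + 3))) (i : Fin (n + 3)) :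
      f (i + 1 + 1) - f (i + 1) = f (i + 1) - f i := by
    have hne : f (i + 1 + 1) ≠ f i := by
      intro h
      have h2 : i + (1 + 1) = i + 0 := by
        simpa [add_assoc] using f.injective h
      have := congrArg Fin.val (add_left_cancel h2)
      rw [Fin.val_add] at this
      simp [Nat.mod_eq_of_lt (show 2 < n + 3 by omega)] at this
    rcases hstep f (i + 1) with h1 | h1 <;> rcases hstep f i with h2 | h2
    · rw [h1, h2]
    · refine absurd (sub_eq_zero.1 ?_) hne
      rw [← sub_add_sub_cancel _ (f (i + 1)), h1, h2]; simp
    · refine absurd (sub_eq_zero.1 ?_) hne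
      rw [← sub_add_sub_cancel _ (f (i + 1)), h1, h2]; simp
    · rw [h1, h2]
  have hinj : Function.Injective (fun f : Copy (cycleGraph (n + 3)) (cycleGraph (n + 3)) ↦
      ((⟨f 1 - f 0, by simpa using hstep f 0⟩, f 0) :
        ({1, -1} : Finset (Fin (n + 3))) × Fin (n + 3))) := by
    intro f g h
    simp only [Prod.mk.injEq, Subtype.mk.injEq] at h
    have key (i : Fin (n + 3)) : f i = g i ∧ f (i + 1) - f i = g (i + 1) - g i := by
      induction i using Fin.induction with
      | zero => simpa using And.intro h.2 h.1
      | succ i ih =>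
        rw [← Fin.coeSucc_eq_succ]
        refine ⟨?_, by rw [hconst, hconst]; exact ih.2⟩
        have := ih.2
        rwa [ih.1, sub_left_inj] at this
    ext i : 1
    exact (key i).1
  rw [labelledCopyCount_eq_natCard]
  refine (Nat.card_le_card_of_injective _ hinj).trans ?_
  rw [Nat.card_prod, Nat.card_eq_fintype_card, Fintype.card_coe, Nat.card_fin]
  exact Nat.mul_le_mul_right _ card_le_two

/-- Composition with a nontrivial involution of `H` pairs up the labelled copies
of `H` with a given image. -/
lemma two_mul_copyCount_le_labelledCopyCount (G : SimpleGraph V)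
    (r : Copy H H) (hrr : ∀ i, r (r i) = i) (hr1 : ∃ i, r i ≠ i) :
    2 * G.copyCount H ≤ G.labelledCopyCount H := by
  classical
  rw [copyCount_eq_card_image_copyToSubgraph, labelledCopyCount, ← card_univ]
  refine mul_card_image_le_card _ _ fun S hS ↦ ?_
  obtain ⟨f, -, rfl⟩ := mem_image.1 hS
  have hr : (f.comp r).toSubgraph = f.toSubgraph := by
    refine Subgraph.ext ?_ ?_
    · ext v
      simp only [Subgraph.map_verts, Subgraph.verts_top, Set.image_univ, Set.mem_range]
      exact ⟨fun ⟨i, hi⟩ ↦ ⟨r i, hi⟩, fun ⟨i, hi⟩ ↦ ⟨r i, by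
        rw [← hi]; exact congrArg f (hrr i)⟩⟩
    · ext v w
      constructor
      · rintro ⟨a, b, hab, rfl, rfl⟩
        exact ⟨r a, r b, r.toHom.map_adj hab, rfl, rfl⟩
      · rintro ⟨a, b, hab, rfl, rfl⟩
        exact ⟨r a, r b, r.toHom.map_adj hab, congrArg f (hrr a), congrArg f (hrr b)⟩
  have hne : f ≠ f.comp r := by
    intro h
    obtain ⟨i, hi⟩ := hr1
    exact hi (f.injective (DFunLike.congr_fun h i)).symm
  rw [← card_pair hne]
  refine card_le_card fun g hg ↦ ?_
  rcases mem_insert.1 hg with rfl | hg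
  · simp
  · rw [mem_singleton.1 hg]
    simpa using hr

lemma two_mul_copyCount_pathGraph_le {k : ℕ} (hk : 1 ≤ k) (G : SimpleGraph V) :
    2 * G.copyCount (pathGraph (k + 1)) ≤ G.labelledCopyCount (pathGraph (k + 1)) := by
  refine two_mul_copyCount_le_labelledCopyCount G
    (⟨⟨Fin.rev, fun {a b} hab ↦ by
      rw [pathGraph_adj] at hab ⊢
      simp only [Fin.val_rev]
      omega⟩, Fin.rev_injective⟩ : Copy (pathGraph (k + 1)) (pathGraph (k + 1)))
    Fin.rev_rev ⟨0, fun h ↦ ?_⟩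
  have := congrArg Fin.val (show Fin.rev (0 : Fin (k + 1)) = 0 from h)
  simp only [Fin.val_rev, Fin.val_zero] at this
  omega

end Copies

end SimpleGraph

/-! ### Closed walks and cycles -/

namespace SimpleGraph

open Finset

section Walks

variable {V : Type*} {G : SimpleGraph V}

lemma exists_walk_getVert_eq (n : ℕ) (g : ℕ → V) (hg : ∀ i < n, G.Adj (g i) (g (i + 1))) :
    ∃ p : G.Walk (g 0) (g n), p.length = n ∧ ∀ i ≤ n, p.getVert i = g i := by
  induction n generalizing g with
  | zero => exact ⟨.nil, rfl, fun i hi ↦ by simp [Nat.le_zero.1 hi]⟩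
  | succ n ih =>
    obtain ⟨p, hp, hpg⟩ := ih (fun i ↦ g (i + 1)) fun i hi ↦ hg (i + 1) (by omega)
    refine ⟨.cons (hg 0 (by omega)) p, by simp [hp], fun i hi ↦ ?_⟩
    cases i with
    | zero => simp
    | succ i => simpa using hpg i (by omega)

/-- The closed walks of length `n` in `G`, with their base vertex. -/
abbrev ClosedWalk (G : SimpleGraph V) (n : ℕ) : Type _ :=
  Σ u : V, {p : G.Walk u u | p.length = n}

lemma ClosedWalk.ext_getVert {n : ℕ} {w w' : G.ClosedWalk n}
    (h : ∀ i < n, w.2.1.getVert i = w'.2.1.getVert i) (h0 : w.1 = w'.1) : w = w' := by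
  obtain ⟨u, p, hp⟩ := w
  obtain ⟨u', p', hp'⟩ := w'
  obtain rfl : u = u' := h0
  simp only [Set.mem_ofPred_eq] at hp hp'
  have : p = p' := Walk.ext_getVert_le_length (hp.trans hp'.symm) fun i hi ↦ by
    rcases hi.lt_or_eq with hi | rfl
    · exact h i (by omega)
    · rw [Walk.getVert_length, hp, ← hp', Walk.getVert_length]
  subst this
  rfl

variable [Fintype V] [DecidableEq V]

lemma labelledCopyCount_pathGraph_le_sum_pow (G : SimpleGraph V) [DecidableRel G.Adj] (k : ℕ) :
    (G.labelledCopyCount (pathGraph (k + 1)) : ℝ) ≤ ∑ u, ∑ v, (G.adjMatrix ℝ ^ k) u v := by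
  simp only [adjMatrix_pow_apply_eq_card_walk]
  norm_cast
  rw [labelledCopyCount_eq_natCard]
  have hw (f : Copy (pathGraph (k + 1)) G) :
      ∃ w : Σ u v, {p : G.Walk u v | p.length = k}, ∀ i : Fin (k + 1),
        w.2.2.1.getVert i = f i := by
    obtain ⟨p, hp, hpf⟩ := exists_walk_getVert_eq (G := G) k (fun i ↦ f (Fin.ofNat (k + 1) i))
      fun i hi ↦ f.toHom.map_adj <| by
        rw [pathGraph_adj]
        left
        simp [Nat.mod_eq_of_lt (show i < k + 1 by omega),
          Nat.mod_eq_of_lt (show i + 1 < k + 1 by omega)]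
    refine ⟨⟨_, _, p, hp⟩, fun i ↦ ?_⟩
    rw [hpf i (by omega)]
    simp
  choose w hw using hw
  have hinj : Function.Injective w := fun f g h ↦ by
    ext i
    rw [← hw, ← hw, h]
  simpa [Nat.card_eq_fintype_card, Fintype.card_sigma] using
    Nat.card_le_card_of_injective w hinj

lemma card_closedWalk (G : SimpleGraph V) [DecidableRel G.Adj] (n : ℕ) :
    (Fintype.card (G.ClosedWalk n) : ℝ) = ∑ x, (G.adjMatrix ℝ ^ n) x x := by
  simp only [adjMatrix_pow_apply_eq_card_walk, Fintype.card_sigma, Nat.cast_sum]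

/-- A closed walk that is at the same vertex `x` at times `i` and `j` splits into the closed walk at
`x` between these times and the closed walk at `x` that runs through the base vertex. -/
lemma card_closedWalk_getVert_eq_le (G : SimpleGraph V) [DecidableRel G.Adj] {n i j : ℕ}
    (hij : i < j) (hj : j < n) :
    (#{w : G.ClosedWalk n | w.2.1.getVert i = w.2.1.getVert j} : ℝ) ≤
      ∑ x, (G.adjMatrix ℝ ^ (j - i)) x x * (G.adjMatrix ℝ ^ (n - (j - i))) x x := by
  classical
  simp only [adjMatrix_pow_apply_eq_card_walk]
  norm_cast
  have hsplit (w : {w : G.ClosedWalk n // w.2.1.getVert i = w.2.1.getVert j}) :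
      ∃ s : Σ x, {p : G.Walk x x | p.length = j - i} × {p : G.Walk x x | p.length = n - (j - i)},
        (∀ l ≤ j - i, s.2.1.1.getVert l = w.1.2.1.getVert (i + l)) ∧
        (∀ l < n - j, s.2.2.1.getVert l = w.1.2.1.getVert (j + l)) ∧
        (∀ l ≤ i, s.2.2.1.getVert (n - j + l) = w.1.2.1.getVert l) := by
    obtain ⟨⟨u, p, hp⟩, hw⟩ := w
    simp only [Set.mem_ofPred_eq] at hp hw
    -- The second part runs from time `j` through the base vertex to time `i`.
    refine ⟨⟨p.getVert i, ⟨((p.drop i).take (j - i)).copy rfl (by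
      rw [Walk.drop_getVert, hw]; congr 1; omega), ?_⟩,
      ⟨((p.drop j).append (p.take i)).copy hw.symm rfl, ?_⟩⟩, ?_, ?_, ?_⟩
    · simp [hp]; omega
    · simp [hp]; omega
    · intro l hl
      simp [hl]
    · intro l hl
      simp [Walk.getVert_append, hp, hl]
    · intro l hl
      simp [Walk.getVert_append, hp, hl]
  choose s hs₁ hs₂ hs₃ using hsplit
  have hinj : Function.Injective s := fun w w' h ↦ by
    have key : ∀ l < n, w.1.2.1.getVert l = w'.1.2.1.getVert l := by
      intro l hl
      rcases le_or_gt l i with h1 | h1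
      · rw [← hs₃ w l h1, ← hs₃ w' l h1, h]
      rcases lt_or_ge l j with h2 | h2
      · have e : l = i + (l - i) := by omega
        rw [e, ← hs₁ w _ (by omega), ← hs₁ w' _ (by omega), h]
      · have e : l = j + (l - j) := by omega
        rw [e, ← hs₂ w _ (by omega), ← hs₂ w' _ (by omega), h]
    refine Subtype.ext (ClosedWalk.ext_getVert key ?_)
    simpa using key 0 (by omega)
  have := Fintype.card_le_of_injective s hinj
  simpa [Fintype.card_sigma, Fintype.card_prod, Fintype.card_subtype] using this

lemma card_closedWalk_injOn_le_labelledCopyCount (G : SimpleGraph V) [DecidableRel G.Adj]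
    (n : ℕ) :
    Nat.card {w : G.ClosedWalk (n + 2) // Set.InjOn w.2.1.getVert (Set.Iio (n + 2))} ≤
      G.labelledCopyCount (cycleGraph (n + 2)) := by
  rw [labelledCopyCount_eq_natCard]
  have hadj (w : G.ClosedWalk (n + 2)) (a : Fin (n + 2)) :
      G.Adj (w.2.1.getVert a) (w.2.1.getVert (a + 1 : Fin (n + 2))) := by
    have h := w.2.1.adj_getVert_succ (i := a) (w.2.2.symm ▸ a.2)
    rw [Fin.val_add_one]
    split_ifs with ha
    -- At the last vertex `a + 1` wraps around to `0`, where the closed walk also ends.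
    · have e : (a : ℕ) + 1 = w.2.1.length := by
        rw [w.2.2, ha]; simp
      rw [e, Walk.getVert_length] at h
      simpa using h
    · exact h
  let c (w : {w : G.ClosedWalk (n + 2) // Set.InjOn w.2.1.getVert (Set.Iio (n + 2))}) :
      Copy (cycleGraph (n + 2)) G :=
    ⟨⟨fun a ↦ w.1.2.1.getVert a, fun {a b} hab ↦ by
      rcases cycleGraph_adj.1 hab with h | h
      · obtain rfl : a = b + 1 := sub_eq_iff_eq_add'.1 h
        exact (hadj w.1 b).symm
      · obtain rfl : b = a + 1 := sub_eq_iff_eq_add'.1 h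
        exact hadj w.1 a⟩, fun a b hab ↦ Fin.ext (w.2 a.2 b.2 hab)⟩
  refine Nat.card_le_card_of_injective c fun w w' h ↦ ?_
  have key : ∀ l < n + 2, w.1.2.1.getVert l = w'.1.2.1.getVert l := fun l hl ↦
    DFunLike.congr_fun h (⟨l, hl⟩ : Fin (n + 2))
  refine Subtype.ext (ClosedWalk.ext_getVert key ?_)
  simpa using key 0 (by omega)

/-- Every closed walk either is a labelled cycle or repeats a vertex at some times `i < j`. -/
lemma card_closedWalk_le_labelledCopyCount_add (G : SimpleGraph V) [DecidableRel G.Adj]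
    (n : ℕ) :
    ∑ x, (G.adjMatrix ℝ ^ (n + 2)) x x ≤ G.labelledCopyCount (cycleGraph (n + 2)) +
      ∑ j ∈ range (n + 2), ∑ i ∈ range j,
        ∑ x, (G.adjMatrix ℝ ^ (j - i)) x x * (G.adjMatrix ℝ ^ (n + 2 - (j - i))) x x := by
  classical
  rw [← card_closedWalk, ← card_univ,
    ← card_filter_add_card_filter_not
      (fun w : G.ClosedWalk (n + 2) ↦ Set.InjOn w.2.1.getVert (Set.Iio (n + 2)))]
  push_cast
  refine add_le_add ?_ ?_
  · rw [← Fintype.card_subtype, ← Nat.card_eq_fintype_card]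
    exact_mod_cast G.card_closedWalk_injOn_le_labelledCopyCount n
  · calc _ ≤ (#((range (n + 2)).biUnion fun j ↦ (range j).biUnion fun i ↦
            {w : G.ClosedWalk (n + 2) | w.2.1.getVert i = w.2.1.getVert j}) : ℝ) := by
          refine Nat.cast_le.2 (card_le_card fun w hw ↦ ?_)
          simp only [mem_filter, mem_univ, true_and, Set.InjOn, not_forall, Set.mem_Iio] at hw
          obtain ⟨a, ha, b, hb, hab, hne⟩ := hw
          simp only [mem_biUnion, mem_range, mem_filter, mem_univ, true_and]
          rcases lt_or_gt_of_ne hne with h | h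
          · exact ⟨b, hb, a, h, hab⟩
          · exact ⟨a, ha, b, h, hab.symm⟩
      _ ≤ ∑ j ∈ range (n + 2), ∑ i ∈ range j,
            (#{w : G.ClosedWalk (n + 2) | w.2.1.getVert i = w.2.1.getVert j} : ℝ) := by
          norm_cast
          exact card_biUnion_le.trans (sum_le_sum fun j _ ↦ card_biUnion_le)
      _ ≤ _ := sum_le_sum fun j hj ↦ sum_le_sum fun i hi ↦
          G.card_closedWalk_getVert_eq_le (mem_range.1 hi) (mem_range.1 hj)

end Walks

end SimpleGraph

/-! ### Log-convexity of closed walk counts -/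

section LogConvex

lemma mul_le_mul_succ_of_sq_le {q : ℕ → ℝ} (h0 : ∀ s, 0 ≤ q s)
    (hq : ∀ s, q (s + 1) ^ 2 ≤ q s * q (s + 2)) {a b : ℕ} (hab : a < b) :
    q (a + 1) * q b ≤ q a * q (b + 1) := by
  induction b, hab using Nat.le_induction with
  | base => simpa [sq] using hq a
  | succ b hb ih =>
    rcases (h0 b).eq_or_lt with hb0 | hb0
    · have h1 : q (b + 1) = 0 := by
        have := hq b
        rw [← hb0, zero_mul] at this
        exact pow_eq_zero_iff two_ne_zero |>.1 (le_antisymm this (sq_nonneg _))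
      rw [h1, mul_zero]
      exact mul_nonneg (h0 _) (h0 _)
    · refine le_of_mul_le_mul_left ?_ hb0
      calc q b * (q (a + 1) * q (b + 1)) = (q (a + 1) * q b) * q (b + 1) := by ring
        _ ≤ (q a * q (b + 1)) * q (b + 1) := mul_le_mul_of_nonneg_right ih (h0 _)
        _ = q a * q (b + 1) ^ 2 := by ring
        _ ≤ q a * (q b * q (b + 2)) := mul_le_mul_of_nonneg_left (hq b) (h0 _)
        _ = q b * (q a * q (b + 1 + 1)) := by ring

lemma mul_le_mul_of_sq_le {q : ℕ → ℝ} (h0 : ∀ s, 0 ≤ q s)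
    (hq : ∀ s, q (s + 1) ^ 2 ≤ q s * q (s + 2)) {a b : ℕ} (ha : 1 ≤ a) (hb : 1 ≤ b) :
    q a * q b ≤ q 1 * q (a + b - 1) := by
  wlog hab : a ≤ b generalizing a b
  · rw [mul_comm, add_comm a b]
    exact this hb ha (by omega)
  induction a, ha using Nat.le_induction generalizing b with
  | base => simp
  | succ a ha ih =>
    refine (mul_le_mul_succ_of_sq_le h0 hq (show a < b by omega)).trans ?_
    have := ih (b := b + 1) (by omega) (by omega)
    rwa [show a + 1 + b - 1 = a + (b + 1) - 1 by omega]

/-- If `q 1 * q k` exceeds `η * q (k + 1)`, then by log-convexity every ratio `q (s + 1) / q s` with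
`s ≤ k` is at most `q 1 / η`, so that `q k` is at most `(q 1 / η) ^ k`. -/
lemma mul_le_add_pow_of_sq_le {q : ℕ → ℝ} (h0 : ∀ s, 0 ≤ q s) (hq0 : q 0 = 1)
    (hq : ∀ s, q (s + 1) ^ 2 ≤ q s * q (s + 2)) (k : ℕ) {η : ℝ} (hη : 0 < η) :
    q 1 * q k ≤ η * q (k + 1) + (η ^ k)⁻¹ * q 1 ^ (k + 1) := by
  rcases le_or_gt (q 1 * q k) (η * q (k + 1)) with h | h
  · exact h.trans (le_add_of_nonneg_right (by have := h0 1; positivity))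
  have hk : 0 < q k := by
    refine (h0 k).lt_of_ne fun hk ↦ ?_
    rw [← hk, mul_zero] at h
    exact h.not_ge (mul_nonneg hη.le (h0 _))
  have hratio (s : ℕ) (hs : s ≤ k) : q (s + 1) ≤ q 1 / η * q s := by
    have h1 : q (s + 1) * q k ≤ q s * q (k + 1) := by
      rcases hs.lt_or_eq with hs | rfl
      · exact mul_le_mul_succ_of_sq_le h0 hq hs
      · rw [mul_comm]
    refine le_of_mul_le_mul_right (h1.trans ?_) hk
    have h2 : q (k + 1) ≤ q 1 / η * q k := by
      rw [div_mul_eq_mul_div, le_div_iff₀ hη, mul_comm]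
      exact h.le
    calc q s * q (k + 1) ≤ q s * (q 1 / η * q k) := mul_le_mul_of_nonneg_left h2 (h0 s)
      _ = _ := by ring
  have hpow (s : ℕ) (hs : s ≤ k) : q s ≤ (q 1 / η) ^ s := by
    induction s with
    | zero => simp [hq0]
    | succ s ih =>
      calc q (s + 1) ≤ q 1 / η * q s := hratio s (by omega)
        _ ≤ q 1 / η * (q 1 / η) ^ s :=
          mul_le_mul_of_nonneg_left (ih (by omega)) (div_nonneg (h0 1) hη.le)
        _ = _ := by ring
  calc q 1 * q k ≤ q 1 * (q 1 / η) ^ k := mul_le_mul_of_nonneg_left (hpow k le_rfl) (h0 1)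
    _ = (η ^ k)⁻¹ * q 1 ^ (k + 1) := by rw [div_pow]; ring
    _ ≤ _ := le_add_of_nonneg_left (mul_nonneg hη.le (h0 _))

end LogConvex

namespace Matrix

open Finset

variable {V : Type*} [Fintype V] [DecidableEq V] {A : Matrix V V ℝ}

lemma IsSymm.pow_add_apply_self (hA : A.IsSymm) (a b : ℕ) (x : V) :
    (A ^ (a + b)) x x = ∑ y, (A ^ a) x y * (A ^ b) x y := by
  rw [pow_add, mul_apply]
  exact sum_congr rfl fun y _ ↦ by rw [(hA.pow b).apply x y]

lemma IsSymm.pow_add_apply_self_sq_le (hA : A.IsSymm) (a b : ℕ) (x : V) :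
    ((A ^ (a + b)) x x) ^ 2 ≤ (A ^ (2 * a)) x x * (A ^ (2 * b)) x x := by
  rw [two_mul, two_mul, hA.pow_add_apply_self, hA.pow_add_apply_self, hA.pow_add_apply_self]
  simpa [sq] using sum_mul_sq_le_sq_mul_sq univ (fun y ↦ (A ^ a) x y) fun y ↦ (A ^ b) x y

lemma IsSymm.pow_two_mul_apply_self_nonneg (hA : A.IsSymm) (a : ℕ) (x : V) :
    0 ≤ (A ^ (2 * a)) x x := by
  rw [two_mul, hA.pow_add_apply_self]
  exact sum_nonneg fun y _ ↦ mul_self_nonneg _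

lemma IsSymm.pow_two_mul_apply_self_sq_le (hA : A.IsSymm) (x : V) (s : ℕ) :
    ((A ^ (2 * (s + 1))) x x) ^ 2 ≤ (A ^ (2 * s)) x x * (A ^ (2 * (s + 2))) x x := by
  rw [show 2 * (s + 1) = s + (s + 2) by ring]
  exact hA.pow_add_apply_self_sq_le s (s + 2) x

/-- The diagonal entries of the even powers of `A` are log-convex in the exponent, so among the
products with exponents summing to `2 * k` the most unbalanced one is the largest. Odd exponents
reduce to even ones by the Cauchy–Schwarz inequality. -/
lemma IsSymm.pow_apply_self_mul_le (hA : A.IsSymm) {k l : ℕ} (hl : 2 ≤ l) (hlk : l + 2 ≤ 2 * k)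
    (x : V) :
    (A ^ l) x x * (A ^ (2 * k - l)) x x ≤ (A ^ 2) x x * (A ^ (2 * (k - 1))) x x := by
  set q : ℕ → ℝ := fun s ↦ (A ^ (2 * s)) x x with hqdef
  have h0 : ∀ s, 0 ≤ q s := fun s ↦ hA.pow_two_mul_apply_self_nonneg s x
  have hq : ∀ s, q (s + 1) ^ 2 ≤ q s * q (s + 2) := hA.pow_two_mul_apply_self_sq_le x
  change _ ≤ q 1 * q (k - 1)
  obtain ⟨s, rfl | rfl⟩ := l.even_or_odd'
  · rw [show 2 * k - 2 * s = 2 * (k - s) by omega]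
    have := mul_le_mul_of_sq_le h0 hq (a := s) (b := k - s) (by omega) (by omega)
    rwa [show s + (k - s) - 1 = k - 1 by omega] at this
  · have h1 := hA.pow_add_apply_self_sq_le s (s + 1) x
    have h2 := hA.pow_add_apply_self_sq_le (k - s - 1) (k - s) x
    have h3 := mul_le_mul_of_sq_le h0 hq (a := s) (b := k - s) (by omega) (by omega)
    have h4 := mul_le_mul_of_sq_le h0 hq (a := s + 1) (b := k - s - 1) (by omega) (by omega)
    rw [show s + (k - s) - 1 = k - 1 by omega] at h3
    rw [show s + 1 + (k - s - 1) - 1 = k - 1 by omega] at h4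
    rw [show s + (s + 1) = 2 * s + 1 by ring] at h1
    rw [show k - s - 1 + (k - s) = 2 * k - (2 * s + 1) by omega] at h2
    refine le_of_sq_le_sq ?_ (mul_nonneg (h0 _) (h0 _))
    calc _ = ((A ^ (2 * s + 1)) x x) ^ 2 * ((A ^ (2 * k - (2 * s + 1))) x x) ^ 2 := mul_pow ..
      _ ≤ (q s * q (s + 1)) * (q (k - s - 1) * q (k - s)) :=
        mul_le_mul h1 h2 (sq_nonneg _) (mul_nonneg (h0 _) (h0 _))
      _ = (q s * q (k - s)) * (q (s + 1) * q (k - s - 1)) := by ring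
      _ ≤ (q 1 * q (k - 1)) * (q 1 * q (k - 1)) :=
        mul_le_mul h3 h4 (mul_nonneg (h0 _) (h0 _)) (mul_nonneg (h0 _) (h0 _))
      _ = _ := (sq _).symm

lemma IsSymm.sum_sum_pow_sq (hA : A.IsSymm) (k : ℕ) :
    ∑ u, ∑ v, ((A ^ k) u v) ^ 2 = ∑ x, (A ^ (2 * k)) x x :=
  sum_congr rfl fun u _ ↦ by
    rw [two_mul, hA.pow_add_apply_self]
    exact sum_congr rfl fun v _ ↦ sq _

lemma IsSymm.sum_sum_pow_sq_le (hA : A.IsSymm) (k : ℕ) :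
    (∑ u, ∑ v, (A ^ k) u v) ^ 2 ≤ (Fintype.card V : ℝ) ^ 2 * ∑ x, (A ^ (2 * k)) x x := by
  have h1 : ∑ u, ∑ v, (A ^ k) u v = ∑ x : V × V, (A ^ k) x.1 x.2 :=
    (Fintype.sum_prod_type' _).symm
  have h2 : ∑ u, ∑ v, ((A ^ k) u v) ^ 2 = ∑ x : V × V, ((A ^ k) x.1 x.2) ^ 2 :=
    (Fintype.sum_prod_type' fun u v ↦ ((A ^ k) u v) ^ 2).symm
  rw [← hA.sum_sum_pow_sq, h1, h2]
  refine sq_sum_le_card_mul_sum_sq.trans_eq ?_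
  simp [sq]

end Matrix

namespace SimpleGraph

open Finset

variable {V : Type*} [Fintype V] [DecidableEq V]

lemma adjMatrix_sq_apply_self (G : SimpleGraph V) [DecidableRel G.Adj] (x : V) :
    (G.adjMatrix ℝ ^ 2) x x = G.degree x := by
  rw [sq, adjMatrix_mul_self_apply_self]

lemma sum_degree_sq_eq (G : SimpleGraph V) [DecidableRel G.Adj] :
    ∑ x, (G.degree x : ℝ) ^ 2 = ∑ u, ∑ v, (G.adjMatrix ℝ ^ 2) u v := by
  have hd (x : V) : ∑ u, G.adjMatrix ℝ x u = G.degree x := by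
    simp [adjMatrix_apply, sum_boole, ← card_neighborFinset_eq_degree, neighborFinset_eq_filter]
  calc _ = ∑ x, (∑ u, G.adjMatrix ℝ u x) * ∑ v, G.adjMatrix ℝ x v := by
        refine sum_congr rfl fun x _ ↦ ?_
        rw [← hd x, sq]
        congr 1
        exact sum_congr rfl fun u _ ↦ (G.isSymm_adjMatrix (α := ℝ)).apply u x
    _ = _ := by
        simp only [sq, Matrix.mul_apply, sum_mul_sum]
        rw [sum_comm]
        exact sum_congr rfl fun u _ ↦ sum_comm

/-- For `k = 2` this is the inequality `t ≤ θ * t ^ 2 + θ⁻¹` summed over the entries of the square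
of the adjacency matrix; for `k ≥ 3` the trivial bound on the degrees suffices. -/
lemma sum_degree_pow_le (G : SimpleGraph V) [DecidableRel G.Adj] {k : ℕ} (hk : 2 ≤ k) {θ : ℝ}
    (hθ : 0 < θ) (hθ1 : θ ≤ 1) :
    ∑ x, (G.degree x : ℝ) ^ k ≤ θ * ∑ x, (G.adjMatrix ℝ ^ (2 * k)) x x +
      θ⁻¹ * (Fintype.card V : ℝ) ^ (2 * k - 2) := by
  have hA := G.isSymm_adjMatrix (α := ℝ)
  rcases hk.eq_or_lt with rfl | hk
  · rw [sum_degree_sq_eq, ← hA.sum_sum_pow_sq]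
    calc _ ≤ ∑ u, ∑ v, (θ * ((G.adjMatrix ℝ ^ 2) u v) ^ 2 + θ⁻¹) :=
          sum_le_sum fun u _ ↦ sum_le_sum fun v _ ↦ by
            set t := (G.adjMatrix ℝ ^ 2) u v
            have h : θ * t ^ 2 + θ⁻¹ - t = θ⁻¹ * ((θ * t - 1 / 2) ^ 2 + 3 / 4) := by
              field_simp; ring
            have : 0 ≤ θ⁻¹ * ((θ * t - 1 / 2) ^ 2 + 3 / 4) := by positivity
            linarith
      _ = _ := by
          simp only [sum_add_distrib, ← mul_sum, sum_const, card_univ, nsmul_eq_mul]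
          ring
  · have hH : 0 ≤ ∑ x, (G.adjMatrix ℝ ^ (2 * k)) x x :=
      sum_nonneg fun x _ ↦ hA.pow_two_mul_apply_self_nonneg k x
    rcases isEmpty_or_nonempty V with hV | hV
    · simp; positivity
    have hN : (1 : ℝ) ≤ Fintype.card V := by exact_mod_cast Fintype.card_pos
    calc ∑ x, (G.degree x : ℝ) ^ k ≤ ∑ _x : V, (Fintype.card V : ℝ) ^ k :=
          sum_le_sum fun x _ ↦ by
            gcongr
            exact (G.degree_lt_card_verts x).le
      _ = (Fintype.card V : ℝ) ^ (k + 1) := by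
          rw [sum_const, card_univ, nsmul_eq_mul, pow_succ']
      _ ≤ (Fintype.card V : ℝ) ^ (2 * k - 2) := pow_le_pow_right₀ hN (by omega)
      _ ≤ θ⁻¹ * (Fintype.card V : ℝ) ^ (2 * k - 2) :=
          le_mul_of_one_le_left (by positivity) ((one_le_inv₀ hθ).2 hθ1)
      _ ≤ _ := le_add_of_nonneg_left (by positivity)

end SimpleGraph

/-! ### Supersaturation -/

namespace SimpleGraph

open Finset

lemma adjMatrix_pow_apply_self_mul_le {V : Type*} [Fintype V] [DecidableEq V]
    (G : SimpleGraph V) [DecidableRel G.Adj] {k l : ℕ} (hl : 1 ≤ l) (hlk : l < 2 * k) (x : V) :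
    (G.adjMatrix ℝ ^ l) x x * (G.adjMatrix ℝ ^ (2 * k - l)) x x ≤
      (G.adjMatrix ℝ ^ 2) x x * (G.adjMatrix ℝ ^ (2 * (k - 1))) x x := by
  have hA := G.isSymm_adjMatrix (α := ℝ)
  -- A closed walk of length one would be a loop.
  have h1 : (G.adjMatrix ℝ ^ 1) x x = 0 := by simp
  have h0 : 0 ≤ (G.adjMatrix ℝ ^ 2) x x * (G.adjMatrix ℝ ^ (2 * (k - 1))) x x :=
    mul_nonneg (hA.pow_two_mul_apply_self_nonneg 1 x) (hA.pow_two_mul_apply_self_nonneg _ x)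
  rcases hl.eq_or_lt with rfl | hl
  · rwa [h1, zero_mul]
  rcases (show l + 2 ≤ 2 * k ∨ 2 * k - l = 1 by omega) with h | h
  · exact hA.pow_apply_self_mul_le hl h x
  · rwa [h, h1, mul_zero]

/-- Up to a proportion `δ` and an error `C * |V| ^ (2 * k - 2)`, all closed walks of length `2 * k`
are labelled `2 * k`-cycles. The constant does not depend on the graph. -/
lemma exists_forall_sum_pow_le_labelledCopyCount_cycleGraph {k : ℕ} (hk : 2 ≤ k) {δ : ℝ}
    (hδ : 0 < δ) (hδ1 : δ ≤ 1) :
    ∃ C : ℝ, 0 ≤ C ∧ ∀ {V : Type} [Fintype V] [DecidableEq V] (G : SimpleGraph V)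
      [DecidableRel G.Adj],
      (1 - δ) * ∑ x, (G.adjMatrix ℝ ^ (2 * k)) x x ≤
        G.labelledCopyCount (cycleGraph (2 * k)) + C * (Fintype.card V : ℝ) ^ (2 * k - 2) := by
  obtain ⟨k, rfl⟩ : ∃ k', k = k' + 1 := ⟨k - 1, by omega⟩
  -- `M` bounds the number of pairs of positions that can coincide in a degenerate closed walk;
  -- `η` and `θ` make each of the two error terms at most `δ / 2` times the number of closed walks.
  set M : ℝ := (2 * (k + 1 : ℕ) : ℝ) ^ 2 with hM
  have hM1 : 1 ≤ M := by
    rw [hM]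
    push_cast
    have : (0 : ℝ) ≤ k := Nat.cast_nonneg k
    nlinarith
  set η : ℝ := δ / (2 * M) with hη
  have hη0 : 0 < η := by positivity
  have hη1 : η ≤ 1 := by
    rw [hη, div_le_one (by positivity)]
    linarith
  set θ : ℝ := η ^ k * (δ / (2 * M)) with hθ
  have hθ0 : 0 < θ := by positivity
  have hθ1 : θ ≤ 1 := mul_le_one₀ (pow_le_one₀ hη0.le hη1) hη0.le hη1
  refine ⟨M * ((η ^ k)⁻¹ * θ⁻¹), by positivity, fun {V} _ _ G _ ↦ ?_⟩
  have hA := G.isSymm_adjMatrix (α := ℝ)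
  set H : ℝ := ∑ x, (G.adjMatrix ℝ ^ (2 * (k + 1))) x x with hH
  set S : ℝ := ∑ x, (G.adjMatrix ℝ ^ 2) x x * (G.adjMatrix ℝ ^ (2 * k)) x x with hS
  set N : ℝ := (Fintype.card V : ℝ) with hN
  have hS0 : 0 ≤ S := sum_nonneg fun x _ ↦
    mul_nonneg (hA.pow_two_mul_apply_self_nonneg 1 x) (hA.pow_two_mul_apply_self_nonneg k x)
  have hdeg : H ≤ G.labelledCopyCount (cycleGraph (2 * (k + 1))) + M * S := by
    refine (G.card_closedWalk_le_labelledCopyCount_add (2 * k)).trans (add_le_add le_rfl ?_)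
    calc _ ≤ ∑ j ∈ range (2 * k + 2), ∑ i ∈ range j, S := by
          refine sum_le_sum fun j hj ↦ sum_le_sum fun i hi ↦ sum_le_sum fun x _ ↦ ?_
          rw [mem_range] at hi hj
          exact G.adjMatrix_pow_apply_self_mul_le (k := k + 1) (by omega) (by omega) x
      _ ≤ ∑ j ∈ range (2 * k + 2), (2 * k + 2 : ℕ) * S := by
          refine sum_le_sum fun j hj ↦ ?_
          rw [sum_const, card_range, nsmul_eq_mul]
          exact mul_le_mul_of_nonneg_right (Nat.cast_le.2 (mem_range.1 hj).le) hS0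
      _ = M * S := by
          rw [sum_const, card_range, nsmul_eq_mul, hM]
          push_cast
          ring
  have hSH : S ≤ η * H + (η ^ k)⁻¹ * ∑ x, (G.degree x : ℝ) ^ (k + 1) := by
    rw [hS, hH, mul_sum, mul_sum, ← sum_add_distrib]
    refine sum_le_sum fun x _ ↦ ?_
    rw [← adjMatrix_sq_apply_self]
    exact mul_le_add_pow_of_sq_le (q := fun s ↦ (G.adjMatrix ℝ ^ (2 * s)) x x)
      (fun s ↦ hA.pow_two_mul_apply_self_nonneg s x) (by simp)
      (hA.pow_two_mul_apply_self_sq_le x) k hη0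
  have hdp := G.sum_degree_pow_le hk hθ0 hθ1
  rw [← hH, ← hN] at hdp
  have hfinal : M * S ≤ δ * H + M * ((η ^ k)⁻¹ * θ⁻¹) * N ^ (2 * (k + 1) - 2) := by
    calc M * S ≤ M * (η * H + (η ^ k)⁻¹ * (θ * H + θ⁻¹ * N ^ (2 * (k + 1) - 2))) := by
          gcongr
          exact hSH.trans (by gcongr)
      _ = (M * η + M * ((η ^ k)⁻¹ * θ)) * H +
            M * ((η ^ k)⁻¹ * θ⁻¹) * N ^ (2 * (k + 1) - 2) := by ring
      _ = _ := by
        have h1 : M * η = δ / 2 := by rw [hη]; field_simp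
        have h2 : M * ((η ^ k)⁻¹ * θ) = δ / 2 := by
          rw [hθ, inv_mul_cancel_left₀ (by positivity)]; exact h1
        rw [h1, h2]; ring
  linarith

/-- A version of the supersaturation bound with an explicit error term, uniform in the graph. -/
lemma exists_forall_mul_sq_le_copyCount_cycleGraph {k : ℕ} (hk : 2 ≤ k) {δ : ℝ}
    (hδ : 0 < δ) (hδ1 : δ ≤ 1) :
    ∃ C : ℝ, 0 ≤ C ∧ ∀ {n m : ℕ} (G : SimpleGraph (Fin n)), 0 < n →
      m ≤ G.copyCount (pathGraph (k + 1)) →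
      (1 - δ) / k * ((m : ℝ) / n) ^ 2 ≤
        G.copyCount (cycleGraph (2 * k)) + C * (n : ℝ) ^ (2 * k - 2) := by
  obtain ⟨C, hC, h⟩ := exists_forall_sum_pow_le_labelledCopyCount_cycleGraph hk hδ hδ1
  have hk0 : (0 : ℝ) < k := by exact_mod_cast (by omega : 0 < k)
  refine ⟨C / (4 * k), by positivity, fun {n m} G hn hm ↦ ?_⟩
  classical
  have hn0 : (0 : ℝ) < n := by exact_mod_cast hn
  have hG := h G
  set H : ℝ := ∑ x, (G.adjMatrix ℝ ^ (2 * k)) x x with hH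
  rw [Fintype.card_fin] at hG
  have hm2 : 2 * (m : ℝ) ≤ ∑ u, ∑ v, (G.adjMatrix ℝ ^ k) u v := by
    refine le_trans ?_ (G.labelledCopyCount_pathGraph_le_sum_pow k)
    exact_mod_cast (Nat.mul_le_mul_left 2 hm).trans (two_mul_copyCount_pathGraph_le (by omega) G)
  have hmH : 4 * ((m : ℝ) / n) ^ 2 ≤ H := by
    have h1 := (G.isSymm_adjMatrix (α := ℝ)).sum_sum_pow_sq_le k
    rw [← hH, Fintype.card_fin] at h1
    have h2 := (pow_le_pow_left₀ (by positivity) hm2 2).trans h1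
    rw [div_pow, ← mul_div_assoc, div_le_iff₀ (by positivity)]
    linarith
  have hI : (G.labelledCopyCount (cycleGraph (2 * k)) : ℝ) ≤
      4 * k * G.copyCount (cycleGraph (2 * k)) := by
    have h1 := G.labelledCopyCount_le_mul_copyCount (cycleGraph (2 * k))
    have h2 := labelledCopyCount_cycleGraph_self_le (2 * k - 3)
    rw [Nat.sub_add_cancel (by omega)] at h2
    have h3 := h1.trans (Nat.mul_le_mul_right _ h2)
    rw [← mul_assoc] at h3
    exact_mod_cast h3
  have hfin : 4 * k * ((1 - δ) / k * ((m : ℝ) / n) ^ 2) ≤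
      4 * k * (G.copyCount (cycleGraph (2 * k)) + C / (4 * k) * (n : ℝ) ^ (2 * k - 2)) := by
    calc _ = (1 - δ) * (4 * ((m : ℝ) / n) ^ 2) := by field_simp
      _ ≤ (1 - δ) * H := mul_le_mul_of_nonneg_left hmH (by linarith)
      _ ≤ _ := hG.trans (by gcongr)
      _ ≤ 4 * k * G.copyCount (cycleGraph (2 * k)) + C * (n : ℝ) ^ (2 * k - 2) := by gcongr
      _ = _ := by field_simp
  exact le_of_mul_le_mul_left hfin (by positivity)

end SimpleGraph

/-- The bound on `satex` up to an arbitrary fixed loss `δ`: the error term is absorbed because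
`n ^ (2 * k - 2)` is negligible against `(m / n) ^ 2`. -/
lemma eventually_mul_sq_le_satex {k : ℕ} (hk : 2 ≤ k) {m : ℕ → ℕ}
    (hm : Tendsto (fun n : ℕ => (m n : ℝ) / (n : ℝ) ^ k) atTop atTop) {δ : ℝ}
    (hδ : 0 < δ) (hδ1 : δ ≤ 1) :
    ∀ᶠ n : ℕ in atTop, 0 < m n ∧ 0 < n ∧ ∀ G : SimpleGraph (Fin n),
      m n ≤ G.copyCount (SimpleGraph.pathGraph (k + 1)) →
      (1 / (k : ℝ) - δ) * ((m n : ℝ) / n) ^ 2 ≤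
        G.copyCount (SimpleGraph.cycleGraph (2 * k)) := by
  obtain ⟨C, hC, h⟩ := SimpleGraph.exists_forall_mul_sq_le_copyCount_cycleGraph hk
    (half_pos hδ) (by linarith)
  have hk1 : (1 : ℝ) ≤ k := by exact_mod_cast (by omega : 1 ≤ k)
  filter_upwards [hm.eventually_ge_atTop (2 * C / δ + 1), eventually_gt_atTop 0] with n hn hn0
  have hn0' : (0 : ℝ) < n := by exact_mod_cast hn0
  have hB : 1 ≤ 2 * C / δ + 1 := le_add_of_nonneg_left (by positivity)
  have hratio : (1 : ℝ) ≤ m n / (n : ℝ) ^ k := hB.trans hn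
  refine ⟨?_, hn0, fun G hG ↦ ?_⟩
  · refine Nat.pos_of_ne_zero fun h0 ↦ ?_
    rw [h0] at hratio
    norm_num at hratio
  have hC' : C * (n : ℝ) ^ (2 * k - 2) ≤ δ / 2 * ((m n : ℝ) / n) ^ 2 := by
    have e : ((m n : ℝ) / n) ^ 2 = (m n / (n : ℝ) ^ k) ^ 2 * (n : ℝ) ^ (2 * k - 2) := by
      have : (n : ℝ) ^ (2 * k) = (n : ℝ) ^ (2 * k - 2) * (n : ℝ) ^ 2 := by
        rw [← pow_add]; congr 1; omega
      rw [div_pow, div_pow, ← pow_mul, mul_comm k 2, this]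
      field_simp
    rw [e, ← mul_assoc]
    refine mul_le_mul_of_nonneg_right ?_ (by positivity)
    calc C = δ / 2 * (2 * C / δ) := by field_simp
      _ ≤ δ / 2 * (m n / (n : ℝ) ^ k) :=
        mul_le_mul_of_nonneg_left ((le_add_of_nonneg_right zero_le_one).trans hn) (by positivity)
      _ ≤ δ / 2 * (m n / (n : ℝ) ^ k) ^ 2 := by
        gcongr
        exact le_self_pow₀ hratio two_ne_zero
  have hG' := h G hn0 hG
  have hδk : 1 / (k : ℝ) - δ / 2 ≤ (1 - δ / 2) / k := by
    rw [sub_div]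
    exact sub_le_sub_left (div_le_self (by positivity) hk1) _
  have := mul_le_mul_of_nonneg_right hδk (sq_nonneg ((m n : ℝ) / n))
  linarith

theorem mainTheorem4 (k : ℕ) (hk : 2 ≤ k) (m : ℕ → ℕ)
    (hm : Tendsto (fun n : ℕ => (m n : ℝ) / (n : ℝ) ^ k) atTop atTop) :
    ∃ ε : ℕ → ℝ, Tendsto ε atTop (𝓝 0) ∧
      ∀ᶠ n : ℕ in atTop,
        (((1 / (k : ℝ) - ε n) * ((m n : ℝ) / (n : ℝ)) ^ 2 : ℝ) : EReal) ≤
          ((satex n (SimpleGraph.pathGraph (k + 1)) (m n) (SimpleGraph.cycleGraph (2 * k)) : ℕ∞) :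
            EReal) := by
  set s : ℕ → ℕ∞ := fun n ↦
    satex n (SimpleGraph.pathGraph (k + 1)) (m n) (SimpleGraph.cycleGraph (2 * k)) with hs
  -- A finite value of `satex` is attained by some graph.
  have hattain (n : ℕ) (hn : s n ≠ ⊤) : ∃ G : SimpleGraph (Fin n),
      m n ≤ G.copyCount (SimpleGraph.pathGraph (k + 1)) ∧
        s n = G.copyCount (SimpleGraph.cycleGraph (2 * k)) := by
    have hne : Nonempty {G : SimpleGraph (Fin n) //
        m n ≤ G.copyCount (SimpleGraph.pathGraph (k + 1))} := by
      by_contra h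
      refine hn ?_
      simp only [hs, satex, iInf_eq_top]
      exact fun G hG ↦ absurd ⟨⟨G, hG⟩⟩ h
    obtain ⟨G, hG⟩ := exists_eq_ciInf_of_finite (f := fun G : {G : SimpleGraph (Fin n) //
      m n ≤ G.copyCount (SimpleGraph.pathGraph (k + 1))} ↦
        (G.1.copyCount (SimpleGraph.cycleGraph (2 * k)) : ℕ∞))
    exact ⟨G.1, G.2, by rw [hG, iInf_subtype]; rfl⟩
  -- The least admissible loss: it is zero where no graph has enough paths.
  set ε : ℕ → ℝ := fun n ↦
    if s n = ⊤ then 0 else max 0 (1 / (k : ℝ) - ((s n).toNat : ℝ) / ((m n : ℝ) / n) ^ 2) with hε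
  refine ⟨ε, ?_, ?_⟩
  · rw [tendsto_order]
    refine ⟨fun a ha ↦ Eventually.of_forall fun n ↦ ?_, fun a ha ↦ ?_⟩
    · refine ha.trans_le ?_
      simp only [hε]
      split_ifs
      exacts [le_rfl, le_max_left _ _]
    · have hδ : 0 < min (a / 2) 1 := by positivity
      filter_upwards [eventually_mul_sq_le_satex hk hm hδ (min_le_right _ _)] with n hn
      obtain ⟨hm0, hn0, hn⟩ := hn
      have hm0' : (0 : ℝ) < m n := by exact_mod_cast hm0
      have hn0' : (0 : ℝ) < n := by exact_mod_cast hn0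
      simp only [hε]
      split_ifs with htop
      · exact ha
      obtain ⟨G, hG, hsG⟩ := hattain n htop
      have h1 := hn G hG
      rw [hsG, ENat.toNat_natCast, max_lt_iff]
      refine ⟨ha, ?_⟩
      rw [← le_div_iff₀ (by positivity)] at h1
      have := min_le_left (a / 2) 1
      linarith
  · filter_upwards [eventually_mul_sq_le_satex hk hm one_pos le_rfl] with n hn
    obtain ⟨hm0, hn0, -⟩ := hn
    have hm0' : (0 : ℝ) < m n := by exact_mod_cast hm0
    have hn0' : (0 : ℝ) < n := by exact_mod_cast hn0
    change _ ≤ ((s n : ℕ∞) : EReal)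
    by_cases htop : s n = ⊤
    · rw [htop]
      exact le_top
    obtain ⟨G, hG, hsG⟩ := hattain n htop
    have hb : (1 / (k : ℝ) - ε n) * ((m n : ℝ) / n) ^ 2 ≤
        G.copyCount (SimpleGraph.cycleGraph (2 * k)) := by
      rw [← le_div_iff₀ (by positivity)]
      have : 1 / (k : ℝ) - ((s n).toNat : ℝ) / ((m n : ℝ) / n) ^ 2 ≤ ε n := by
        simp only [hε, if_neg htop]
        exact le_max_right _ _
      rw [hsG, ENat.toNat_natCast] at this
      linarith
    rw [hsG]
    have hcast (c : ℕ) : (((c : ℕ∞) : EReal)) = ((c : ℝ) : EReal) := rfl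
    rw [hcast]
    exact EReal.coe_le_coe_iff.2 hb
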